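/- Let $n\ge 1$ and let $\omega=(\boldsymbol\omega_j)_{j\ge1}$, $\boldsymbol\omega_j=(\omega_{j,1},\dots,\omega_{j,n})$, be a sequence of points in $[0,1]^n$. Write $\lambda_n$ for Lebesgue measure, and for $N\ge 1$ let $$D_N=D_N(\omega)=\sup_{R}\left|\frac{\#\{1\le j\le N:\boldsymbol\omega_j\in R\}}{N}-\lambda_n(R)\right|,$$ where the supremum is over all rectangles $R=\prod_{i=1}^n[a_i,b_i)$ with $0\le a_i<b_i\le 1$. Suppose that $\omega$ has low discrepancy: there is a constant $C>0$ (which may depend on $\omega$) such that $D_N\le C(\log N)^n/N$ for all sufficiently large $N$. Let $\tau_1,\dots,\tau_n>0$ with $\sum_{i=1}^n\tau_i=1$, and let $\psi_1,\dots,\psi_n:\{1,2,3,\dots\}\to[0,\infty)$ be non-increasing functions such that, for all sufficiently large $N$, $$\psi_i(N)\le D_N^{\tau_i}\qquad(1\le i\le n).$$ Let $\Psi=(\psi_1,\dots,\psi_n)$ and let $$W_\omega(\Psi)=\left\{\mathbf x\in[0,1]^n:\ |x_i-\omega_{j,i}|<\psi_i(j)\ (1\le i\le n)\ \text{for infinitely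 many } j\ge 1\right\}.$$ If for some real number $M>1$ $$\sum_{j=1}^\infty \frac{M^{j^2}}{j^{2n}}\prod_{i=1}^n\psi_i\!\left(\lfloor M^{j^2}\rfloor\right)=\infty$$ (when $M$ is an integer, the integer parts can be omitted), then $\lambda_n(W_\omega(\Psi))=1$. -/

import Mathlib

open Filter MeasureTheory

noncomputable section

namespace UnifApprox

/-- The half-open rectangle `{x : a i ≤ x i < b i for all i}`. -/
def rectangle {n : ℕ} (a b : Fin n → ℝ) : Set (Fin n → ℝ) :=
  {x | ∀ i, a i ≤ x i ∧ x i < b i}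

open Classical in
/-- `A(R; N, ω)`: the number of indices `1 ≤ j ≤ N` with `ω j ∈ R`.
Sequences are indexed by `j ≥ 1`; the value `ω 0` is never used. -/
def countIn {n : ℕ} (R : Set (Fin n → ℝ)) (N : ℕ) (ω : ℕ → Fin n → ℝ) : ℕ :=
  ((Finset.Icc 1 N).filter (fun j => ω j ∈ R)).card

/-- The discrepancy `D_N(ω)`: the supremum of `|A(R; N, ω) / N - λ_n(R)|` over all rectangles
`R = ∏ [a i, b i)` with `0 ≤ a i < b i ≤ 1`. -/
def discrepancy {n : ℕ} (ω : ℕ → Fin n → ℝ) (N : ℕ) : ℝ :=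
  sSup {d : ℝ | ∃ a b : Fin n → ℝ, (∀ i, 0 ≤ a i ∧ a i < b i ∧ b i ≤ 1) ∧
    d = |(countIn (rectangle a b) N ω : ℝ) / (N : ℝ) - volume.real (rectangle a b)|}

/-- Low discrepancy: `D_N(ω) ≪ (log N)^n / N`. -/
def HasLowDiscrepancy {n : ℕ} (ω : ℕ → Fin n → ℝ) : Prop :=
  (fun N : ℕ => discrepancy ω N) =O[atTop] (fun N : ℕ => Real.log (N : ℝ) ^ n / (N : ℝ))

/-- `W_ω(Ψ)`: the points `x ∈ [0,1]^n` such that `|x i - ω j i| < ψ i j` for all `i`,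
for infinitely many `j ≥ 1`. -/
def approxSet {n : ℕ} (ω : ℕ → Fin n → ℝ) (ψ : Fin n → ℕ → ℝ) : Set (Fin n → ℝ) :=
  {x | (∀ i, 0 ≤ x i ∧ x i ≤ 1) ∧
    {j : ℕ | 1 ≤ j ∧ ∀ i, |x i - ω j i| < ψ i j}.Infinite}

end UnifApprox

end

namespace UnifApprox

/-! Along `N k = ⌊M ^ (k ^ 2)⌋₊`, low discrepancy gives `D_{N k} < ρ k` with `ρ k = K k^(2n) /
M^(k^2)`. Hence every dyadic box in the unit cube of volume at least `ρ k` contains some `ω j` with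
`1 ≤ j ≤ N k`. Take boxes with sides `2 ^ (-m k i)` comparable to `ρ k ^ τ i`, select one such point
in each, and let `E k` be the union of the smaller dyadic boxes, with sides `2 ^ (-a k i)`
comparable to `ψ i (N k)`, around the selected points.

`E k` fills the same proportion `p k` of each large box, and `p k` is at least a constant times the
`k`-th term `t k` of the series. If `a j i ≤ m k i` for all `j < k`, the complement of the earlier
`E j` is a union of large boxes of stage `k`, so that proportion is exact there too and divergence
of `∑ p k` suffices (`measure_diff_frequently_eq_zero`).

To get this nesting, discard the `k` with `t k < 1 / k ^ 2`, which contribute a convergent series.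
For the others `rpow_mul_prod_div_le` bounds `ψ i (N j)` below by `ρ j ^ τ i / (K j ^ 2)`. This
exceeds `4 ρ k ^ τ i` for large `j < k`, since consecutive `ρ` have ratio `O(M ^ (-j))`
(`eventually_sq_exp_ratio_separated`). -/

/-! ### Dyadic boxes and selected sub-boxes -/

/-- The index of the dyadic box with side lengths `2 ^ (-m i)` containing `x`. -/
noncomputable def dyadicIndex {n : ℕ} (m : Fin n → ℕ) (x : Fin n → ℝ) : Fin n → ℤ :=
  fun i => ⌊(2 : ℝ) ^ m i * x i⌋

theorem measurable_dyadicIndex {n : ℕ} (m : Fin n → ℕ) : Measurable (dyadicIndex m) := by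
  refine measurable_pi_lambda _ fun i => ?_
  exact Int.measurable_floor.comp ((measurable_pi_apply i).const_mul _)

theorem preimage_dyadicIndex_singleton {n : ℕ} (m : Fin n → ℕ) (z : Fin n → ℤ) :
    dyadicIndex m ⁻¹' {z} =
      Set.univ.pi fun i => Set.Ico ((z i : ℝ) / 2 ^ m i) (((z i : ℝ) + 1) / 2 ^ m i) := by
  ext x
  simp only [Set.mem_preimage, Set.mem_singleton_iff, funext_iff, dyadicIndex, Int.floor_eq_iff,
    Set.mem_pi, Set.mem_univ, true_imp_iff, Set.mem_Ico]
  refine forall_congr' fun i => ?_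
  have h : (0 : ℝ) < 2 ^ m i := by positivity
  rw [div_le_iff₀ h, lt_div_iff₀ h, mul_comm]

theorem volume_preimage_dyadicIndex {n : ℕ} (m : Fin n → ℕ) (z : Fin n → ℤ) :
    volume (dyadicIndex m ⁻¹' {z}) = ENNReal.ofReal (∏ i, ((2 : ℝ) ^ m i)⁻¹) := by
  rw [preimage_dyadicIndex_singleton, Real.volume_pi_Ico, ENNReal.ofReal_prod_of_nonneg]
  · refine Finset.prod_congr rfl fun i _ => ?_
    congr 1
    ring
  · intro i _
    positivity

/-- A finer dyadic index determines a coarser one. -/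
theorem dyadicIndex_eq_of_le {n : ℕ} {m a : Fin n → ℕ} (h : ∀ i, m i ≤ a i) {x y : Fin n → ℝ}
    (hxy : dyadicIndex a x = dyadicIndex a y) : dyadicIndex m x = dyadicIndex m y := by
  have key : ∀ w : Fin n → ℝ, ∀ i, dyadicIndex m w i = dyadicIndex a w i / (2 ^ (a i - m i) : ℕ) := by
    intro w i
    unfold dyadicIndex
    rw [← Int.floor_div_natCast]
    congr 1
    push_cast
    rw [← Nat.add_sub_of_le (h i), pow_add]
    simp only [Nat.add_sub_cancel_left]
    field_simp
  funext i
  rw [key, key, hxy]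

theorem abs_sub_lt_of_dyadicIndex_eq {n : ℕ} {a : Fin n → ℕ} {x y : Fin n → ℝ}
    (hxy : dyadicIndex a x = dyadicIndex a y) (i : Fin n) : |x i - y i| < ((2 : ℝ) ^ a i)⁻¹ := by
  have h := Int.abs_sub_lt_one_of_floor_eq_floor (congrFun hxy i)
  have ha : (0 : ℝ) < 2 ^ a i := by positivity
  rw [← mul_sub, abs_mul, abs_of_pos ha] at h
  rwa [← one_div, lt_div_iff₀' ha]

/-- The half-open unit cube. -/
def unitBox (n : ℕ) : Set (Fin n → ℝ) := dyadicIndex (fun _ => 0) ⁻¹' {0}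

theorem mem_unitBox {n : ℕ} {x : Fin n → ℝ} : x ∈ unitBox n ↔ ∀ i, 0 ≤ x i ∧ x i < 1 := by
  simp [unitBox, preimage_dyadicIndex_singleton]

theorem volume_unitBox (n : ℕ) : volume (unitBox n) = 1 := by
  simp [unitBox, volume_preimage_dyadicIndex]

/-- `G` is a union of dyadic boxes with side lengths `2 ^ (-m i)`. -/
def IsDyadicUnion {n : ℕ} (m : Fin n → ℕ) (G : Set (Fin n → ℝ)) : Prop :=
  ∀ x ∈ G, ∀ y, dyadicIndex m y = dyadicIndex m x → y ∈ G

theorem IsDyadicUnion.mono {n : ℕ} {m a : Fin n → ℕ} (h : ∀ i, m i ≤ a i)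
    {G : Set (Fin n → ℝ)} (hG : IsDyadicUnion m G) : IsDyadicUnion a G :=
  fun x hx y hy => hG x hx y (dyadicIndex_eq_of_le h hy)

theorem IsDyadicUnion.measurableSet {n : ℕ} {m : Fin n → ℕ} {G : Set (Fin n → ℝ)}
    (hG : IsDyadicUnion m G) : MeasurableSet G := by
  have : G = dyadicIndex m ⁻¹' (dyadicIndex m '' G) := by
    refine (Set.subset_preimage_image _ _).antisymm ?_
    rintro y ⟨x, hx, hxy⟩
    exact hG x hx y hxy.symm
  rw [this]
  exact measurable_dyadicIndex m (Set.to_countable _).measurableSet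

theorem IsDyadicUnion.diff {n : ℕ} {m : Fin n → ℕ} {G H : Set (Fin n → ℝ)}
    (hG : IsDyadicUnion m G) (hH : IsDyadicUnion m H) : IsDyadicUnion m (G \ H) :=
  fun x hx y hy => ⟨hG x hx.1 y hy, fun hyH => hx.2 (hH y hyH x hy.symm)⟩

theorem isDyadicUnion_unitBox {n : ℕ} (m : Fin n → ℕ) : IsDyadicUnion m (unitBox n) := by
  refine IsDyadicUnion.mono (m := fun _ => 0) (fun _ => Nat.zero_le _) fun x hx y hy => ?_
  rw [unitBox, Set.mem_preimage] at *
  rwa [hy]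

theorem measure_eq_tsum_inter_fiber {α ι : Type*} [MeasurableSpace α] [MeasurableSpace ι]
    [Countable ι] [MeasurableSingletonClass ι] (μ : Measure α) {f : α → ι} (hf : Measurable f)
    {A : Set α} (hA : MeasurableSet A) : μ A = ∑' z, μ (A ∩ f ⁻¹' {z}) := by
  rw [← measure_iUnion]
  · congr 1
    ext x
    simp
  · intro z w hzw
    refine Set.disjoint_left.2 fun x hx hx' => hzw ?_
    rw [← hx.2, ← hx'.2]
  · exact fun z => hA.inter (hf (measurableSet_singleton z))

/-- The union over the dyadic boxes `Q` of type `m` in the unit cube of the dyadic box of type `a`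
containing the point of `Q` selected by `c`. -/
def selectedBoxes {n : ℕ} (m a : Fin n → ℕ) (c : (Fin n → ℤ) → Fin n → ℝ) : Set (Fin n → ℝ) :=
  {x | x ∈ unitBox n ∧ dyadicIndex a x = dyadicIndex a (c (dyadicIndex m x))}

theorem isDyadicUnion_selectedBoxes {n : ℕ} {m a : Fin n → ℕ} (h : ∀ i, m i ≤ a i)
    (c : (Fin n → ℤ) → Fin n → ℝ) : IsDyadicUnion a (selectedBoxes m a c) := by
  rintro x ⟨hx, hxc⟩ y hy
  refine ⟨isDyadicUnion_unitBox a x hx y hy, ?_⟩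
  rw [hy, hxc, dyadicIndex_eq_of_le h hy]

/-- Each large box in `G` meets the selected set in exactly one whole small box, because `hc` places
the selected point in that large box. The proportion is therefore the same everywhere. -/
theorem volume_inter_selectedBoxes {n : ℕ} {m a : Fin n → ℕ} (h : ∀ i, m i ≤ a i)
    {c : (Fin n → ℤ) → Fin n → ℝ}
    (hc : ∀ x ∈ unitBox n, dyadicIndex m (c (dyadicIndex m x)) = dyadicIndex m x)
    {G : Set (Fin n → ℝ)} (hG : IsDyadicUnion m G) (hGU : G ⊆ unitBox n) :
    volume (G ∩ selectedBoxes m a c) =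
      ENNReal.ofReal (∏ i, (2 : ℝ) ^ m i / 2 ^ a i) * volume G := by
  have hE := (isDyadicUnion_selectedBoxes h c).measurableSet
  rw [measure_eq_tsum_inter_fiber volume (measurable_dyadicIndex m) (hG.measurableSet.inter hE),
    measure_eq_tsum_inter_fiber volume (measurable_dyadicIndex m) hG.measurableSet,
    ← ENNReal.tsum_mul_left]
  refine tsum_congr fun z => ?_
  by_cases hz : ∃ x ∈ G, dyadicIndex m x = z
  · obtain ⟨x, hx, rfl⟩ := hz
    have h1 : G ∩ dyadicIndex m ⁻¹' {dyadicIndex m x} = dyadicIndex m ⁻¹' {dyadicIndex m x} :=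
      Set.inter_eq_right.2 fun y hy => hG x hx y hy
    have h2 : G ∩ selectedBoxes m a c ∩ dyadicIndex m ⁻¹' {dyadicIndex m x} =
        dyadicIndex a ⁻¹' {dyadicIndex a (c (dyadicIndex m x))} := by
      ext y
      constructor
      · rintro ⟨⟨-, hy⟩, hyx⟩
        have hyx : dyadicIndex m y = dyadicIndex m x := hyx
        have := hy.2
        rwa [hyx] at this
      · intro hy
        have hyx : dyadicIndex m y = dyadicIndex m x :=
          (dyadicIndex_eq_of_le h hy).trans (hc x (hGU hx))
        have hyG := hG x hx y hyx
        refine ⟨⟨hyG, hGU hyG, ?_⟩, hyx⟩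
        rw [hyx]
        exact hy
    rw [h1, h2, volume_preimage_dyadicIndex, volume_preimage_dyadicIndex,
      ← ENNReal.ofReal_mul (by positivity), ← Finset.prod_mul_distrib]
    congr 1
    refine Finset.prod_congr rfl fun i _ => ?_
    field_simp
  · have h1 : G ∩ dyadicIndex m ⁻¹' {z} = ∅ := by
      ext y
      simp only [Set.mem_inter_iff, Set.mem_preimage, Set.mem_singleton_iff, Set.mem_empty_iff_false,
        iff_false, not_and]
      exact fun hy hyz => hz ⟨y, hy, hyz⟩
    rw [h1, Set.inter_right_comm, h1]
    simp

/-! ### Borel-Cantelli for nested dyadic scales -/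

/-- A divergence Borel-Cantelli lemma: if `E k` occupies at least the proportion `p k` of
`F \ ⋃ E j`, the union being over `J ≤ j < k`, and `∑ p k = ∞`, then almost every point of `F` lies
in infinitely many `E k`. -/
theorem measure_diff_frequently_eq_zero {α : Type*} [MeasurableSpace α] {μ : Measure α}
    {F : Set α} (hF : μ F ≠ ⊤) {E : ℕ → Set α} (hE : ∀ k, MeasurableSet (E k)) {p : ℕ → ℝ}
    (hp0 : ∀ k, 0 ≤ p k) (hp : ¬ Summable p)
    (h : ∀ J k, J ≤ k → ENNReal.ofReal (p k) * μ (F \ ⋃ j ∈ Finset.Ico J k, E j) ≤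
      μ ((F \ ⋃ j ∈ Finset.Ico J k, E j) ∩ E k)) :
    μ {x ∈ F | ¬ ∃ᶠ k in atTop, x ∈ E k} = 0 := by
  -- A point in only finitely many `E k` avoids all of them from some index `J` on.
  have hsub : {x ∈ F | ¬ ∃ᶠ k in atTop, x ∈ E k} ⊆ ⋃ J, F \ ⋃ j ∈ Set.Ici J, E j := by
    rintro x ⟨hxF, hx⟩
    rw [not_frequently, eventually_atTop] at hx
    obtain ⟨J, hJ⟩ := hx
    refine Set.mem_iUnion.2 ⟨J, hxF, ?_⟩
    simp only [Set.mem_iUnion, not_exists]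
    exact fun j hj => hJ j hj
  refine measure_mono_null hsub (measure_iUnion_null fun J => ?_)
  have hbound : ∀ K, J ≤ K → μ.real (F \ ⋃ j ∈ Finset.Ico J K, E j) ≤
      Real.exp (-∑ j ∈ Finset.Ico J K, p j) * μ.real F := by
    intro K hK
    induction K, hK using Nat.le_induction with
    | base => simp
    | succ K hK ih =>
      set G := F \ ⋃ j ∈ Finset.Ico J K, E j with hGdef
      have hG : μ G ≠ ⊤ := measure_ne_top_of_subset Set.sdiff_subset hF
      have hset : F \ ⋃ j ∈ Finset.Ico J (K + 1), E j = G \ E K := by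
        ext x
        simp only [hGdef, Set.mem_sdiff, Set.mem_iUnion, Finset.mem_Ico, not_exists]
        constructor
        · rintro ⟨hx, hxj⟩
          exact ⟨⟨hx, fun j hj => hxj j (by omega)⟩, hxj K (by omega)⟩
        · rintro ⟨⟨hx, hxj⟩, hxK⟩
          refine ⟨hx, fun j hj => ?_⟩
          rcases eq_or_ne j K with rfl | hne
          · exact hxK
          · exact hxj j (by omega)
      have h1 : p K * μ.real G ≤ μ.real (G ∩ E K) := by
        have := ENNReal.toReal_mono (measure_ne_top_of_subset Set.inter_subset_left hG) (h J K hK)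
        rwa [ENNReal.toReal_mul, ENNReal.toReal_ofReal (hp0 K)] at this
      have h2 : μ.real (G ∩ E K) + μ.real (G \ E K) = μ.real G :=
        measureReal_inter_add_sdiff (hE K) hG
      have h3 : 1 - p K ≤ Real.exp (-p K) := by
        have := Real.add_one_le_exp (-p K)
        linarith
      rw [hset, Finset.sum_Ico_succ_top hK, neg_add, Real.exp_add]
      calc μ.real (G \ E K) ≤ (1 - p K) * μ.real G := by linarith
        _ ≤ Real.exp (-p K) * μ.real G := by gcongr
        _ ≤ Real.exp (-p K) * (Real.exp (-∑ j ∈ Finset.Ico J K, p j) * μ.real F) := by gcongr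
        _ = _ := by ring
  have htend : Tendsto (fun K => Real.exp (-∑ j ∈ Finset.Ico J K, p j) * μ.real F) atTop
      (nhds 0) := by
    rw [← zero_mul (μ.real F)]
    refine Tendsto.mul_const _ (Real.tendsto_exp_neg_atTop_nhds_zero.comp ?_)
    have hs := (not_summable_iff_tendsto_nat_atTop_of_nonneg hp0).1 hp
    refine (tendsto_atTop_add_const_right _ (-∑ j ∈ Finset.range J, p j) hs).congr' ?_
    filter_upwards [eventually_ge_atTop J] with K hK
    rw [Finset.sum_Ico_eq_sub _ hK, sub_eq_add_neg]
  have hfin : μ (F \ ⋃ j ∈ Set.Ici J, E j) ≠ ⊤ := measure_ne_top_of_subset Set.sdiff_subset hF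
  have hzero : μ.real (F \ ⋃ j ∈ Set.Ici J, E j) ≤ 0 := by
    refine ge_of_tendsto htend ?_
    filter_upwards [eventually_ge_atTop J] with K hK
    refine (measureReal_mono ?_ (measure_ne_top_of_subset Set.sdiff_subset hF)).trans (hbound K hK)
    refine Set.sdiff_subset_sdiff_right (Set.iUnion₂_subset fun j hj => ?_)
    exact Set.subset_biUnion_of_mem (u := E) (Finset.mem_Ico.1 hj).1
  exact (measureReal_eq_zero_iff hfin).1 (le_antisymm hzero measureReal_nonneg)

/-- `ham` makes every earlier set a union of boxes of the current large type, so what remains of the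
cube is one as well and loses the exact proportion. -/
theorem volume_not_frequently_near_eq_zero {n : ℕ} {S : Set ℕ} {m a : ℕ → Fin n → ℕ}
    {P : ℕ → Set (Fin n → ℝ)} (hma : ∀ k ∈ S, ∀ i, m k i ≤ a k i)
    (ham : ∀ j ∈ S, ∀ k ∈ S, j < k → ∀ i, a j i ≤ m k i)
    (hP : ∀ k ∈ S, ∀ x ∈ unitBox n, ∃ y ∈ P k, dyadicIndex (m k) y = dyadicIndex (m k) x)
    (hdiv : ¬ Summable (S.indicator fun k => ∏ i, (2 : ℝ) ^ m k i / 2 ^ a k i)) :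
    volume {x ∈ unitBox n | ¬ ∃ᶠ k in atTop,
      k ∈ S ∧ ∃ y ∈ P k, ∀ i, |x i - y i| < ((2 : ℝ) ^ a k i)⁻¹} = 0 := by
  have hc : ∀ k : ℕ, ∃ c : (Fin n → ℤ) → Fin n → ℝ, k ∈ S → ∀ x ∈ unitBox n,
      c (dyadicIndex (m k) x) ∈ P k ∧
        dyadicIndex (m k) (c (dyadicIndex (m k) x)) = dyadicIndex (m k) x := by
    intro k
    by_cases hk : k ∈ S
    · have : ∀ z : Fin n → ℤ, ∃ y, ∀ x ∈ unitBox n, dyadicIndex (m k) x = z →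
          y ∈ P k ∧ dyadicIndex (m k) y = z := by
        intro z
        by_cases hz : ∃ x ∈ unitBox n, dyadicIndex (m k) x = z
        · obtain ⟨x, hx, rfl⟩ := hz
          obtain ⟨y, hy⟩ := hP k hk x hx
          exact ⟨y, fun _ _ _ => hy⟩
        · exact ⟨0, fun x hx hxz => (hz ⟨x, hx, hxz⟩).elim⟩
      choose c hc using this
      exact ⟨c, fun _ x hx => hc _ x hx rfl⟩
    · exact ⟨0, fun h => (hk h).elim⟩
  choose c hc using hc
  classical
  set E : ℕ → Set (Fin n → ℝ) := fun k => if k ∈ S then selectedBoxes (m k) (a k) (c k) else ∅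
    with hE
  have hEmeas : ∀ k, MeasurableSet (E k) := by
    intro k
    by_cases hk : k ∈ S
    · simpa [hE, hk] using (isDyadicUnion_selectedBoxes (hma k hk) (c k)).measurableSet
    · simp [hE, hk]
  have hzero := measure_diff_frequently_eq_zero (μ := volume) (F := unitBox n)
    (by simp [volume_unitBox]) hEmeas
    (fun k => Set.indicator_nonneg (fun k _ => by positivity) k) hdiv ?_
  · refine measure_mono_null ?_ hzero
    rintro x ⟨hx, hxf⟩
    refine ⟨hx, fun hf => hxf (hf.mono fun k hk => ?_)⟩
    by_cases hkS : k ∈ S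
    · have hk : x ∈ selectedBoxes (m k) (a k) (c k) := by simpa [hE, hkS] using hk
      exact ⟨hkS, _, (hc k hkS x hx).1, fun i => abs_sub_lt_of_dyadicIndex_eq hk.2 i⟩
    · simp [hE, hkS] at hk
  · intro J k _
    by_cases hk : k ∈ S
    · have hG : IsDyadicUnion (m k) (unitBox n \ ⋃ j ∈ Finset.Ico J k, E j) := by
        refine (isDyadicUnion_unitBox _).diff fun x hx y hy => ?_
        simp only [Set.mem_iUnion] at hx ⊢
        obtain ⟨j, hj, hxj⟩ := hx
        refine ⟨j, hj, ?_⟩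
        by_cases hjS : j ∈ S
        · simp only [hE, hjS, if_true] at hxj ⊢
          exact (isDyadicUnion_selectedBoxes (hma j hjS) (c j)).mono
            (ham j hjS k hk (Finset.mem_Ico.1 hj).2) x hxj y hy
        · simp [hE, hjS] at hxj
      have := volume_inter_selectedBoxes (hma k hk) (fun x hx => (hc k hk x hx).2) hG
        Set.sdiff_subset
      rw [Set.indicator_of_mem hk, ← this]
      simp [hE, hk]
    · simp [hk]

/-! ### Discrepancy and points in boxes -/

theorem countIn_le {n : ℕ} (R : Set (Fin n → ℝ)) (N : ℕ) (ω : ℕ → Fin n → ℝ) :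
    countIn R N ω ≤ N := by
  classical
  unfold countIn
  refine (Finset.card_filter_le _ _).trans ?_
  simp

theorem rectangle_eq_pi {n : ℕ} (a b : Fin n → ℝ) :
    rectangle a b = Set.univ.pi fun i => Set.Ico (a i) (b i) := by
  ext x
  simp [rectangle]

theorem abs_count_sub_volume_le_discrepancy {n : ℕ} (ω : ℕ → Fin n → ℝ) (N : ℕ)
    {a b : Fin n → ℝ} (hab : ∀ i, 0 ≤ a i ∧ a i < b i ∧ b i ≤ 1) :
    |(countIn (rectangle a b) N ω : ℝ) / (N : ℝ) - volume.real (rectangle a b)| ≤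
      discrepancy ω N := by
  refine le_csSup ⟨1, ?_⟩ ⟨a, b, hab, rfl⟩
  rintro d ⟨a, b, hab, rfl⟩
  have h1 : (countIn (rectangle a b) N ω : ℝ) / (N : ℝ) ≤ 1 :=
    div_le_one_of_le₀ (by exact_mod_cast countIn_le _ _ _) (Nat.cast_nonneg _)
  have h2 : 0 ≤ (countIn (rectangle a b) N ω : ℝ) / (N : ℝ) := by positivity
  have h3 : volume.real (rectangle a b) ≤ 1 := by
    rw [rectangle_eq_pi, measureReal_def, Real.volume_pi_Ico_toReal fun i => (hab i).2.1.le]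
    refine Finset.prod_le_one (fun i _ => by linarith [(hab i).2.1]) fun i _ => ?_
    linarith [hab i]
  have h4 : 0 ≤ volume.real (rectangle a b) := measureReal_nonneg
  rw [abs_le]
  constructor <;> linarith

/-- A dyadic box of volume larger than the discrepancy contains a point of the sequence. -/
theorem exists_dyadicIndex_eq {n : ℕ} {ω : ℕ → Fin n → ℝ} {N : ℕ} {m : Fin n → ℕ}
    (h : discrepancy ω N < ∏ i, ((2 : ℝ) ^ m i)⁻¹) {x : Fin n → ℝ} (hx : x ∈ unitBox n) :
    ∃ y ∈ ω '' Set.Icc 1 N, dyadicIndex m y = dyadicIndex m x := by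
  set z := dyadicIndex m x with hz
  have hpos : ∀ i, (0 : ℝ) < 2 ^ m i := fun i => by positivity
  have hx := mem_unitBox.1 hx
  have hz0 : ∀ i, 0 ≤ z i := fun i => Int.floor_nonneg.2 (mul_nonneg (hpos i).le (hx i).1)
  have hz1 : ∀ i, z i + 1 ≤ 2 ^ m i := by
    intro i
    rw [Int.add_one_le_iff, hz, dyadicIndex, Int.floor_lt]
    push_cast
    nlinarith [hx i, hpos i]
  have hR : rectangle (fun i => (z i : ℝ) / 2 ^ m i) (fun i => ((z i : ℝ) + 1) / 2 ^ m i) =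
      dyadicIndex m ⁻¹' {z} := by
    rw [rectangle_eq_pi, preimage_dyadicIndex_singleton]
  have hD := abs_count_sub_volume_le_discrepancy ω N
    (a := fun i => (z i : ℝ) / 2 ^ m i) (b := fun i => ((z i : ℝ) + 1) / 2 ^ m i) (fun i => by
      refine ⟨div_nonneg (by exact_mod_cast hz0 i) (hpos i).le, ?_, ?_⟩
      · exact (div_lt_div_iff_of_pos_right (hpos i)).2 (lt_add_one _)
      · rw [div_le_one (hpos i)]
        exact_mod_cast hz1 i)
  rw [hR, measureReal_def, volume_preimage_dyadicIndex,
    ENNReal.toReal_ofReal (by positivity)] at hD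
  have hcount : countIn (dyadicIndex m ⁻¹' {z}) N ω ≠ 0 := by
    intro h0
    rw [h0, Nat.cast_zero, zero_div, zero_sub, abs_neg, abs_of_nonneg (by positivity)] at hD
    exact absurd h (not_lt.2 hD)
  classical
  unfold countIn at hcount
  obtain ⟨j, hj⟩ := Finset.card_ne_zero.1 hcount
  rw [Finset.mem_filter, Finset.mem_Icc] at hj
  exact ⟨ω j, ⟨j, hj.1, rfl⟩, hj.2⟩

/-! ### Choice of dyadic side lengths -/

theorem exists_two_pow_inv_near {s : ℝ} (hs : 0 < s) (hs1 : s ≤ 1) :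
    ∃ b : ℕ, s ≤ ((2 : ℝ) ^ b)⁻¹ ∧ ((2 : ℝ) ^ b)⁻¹ ≤ 2 * s := by
  obtain ⟨b, hb, hb'⟩ := exists_nat_pow_near ((one_le_inv₀ hs).2 hs1) one_lt_two
  refine ⟨b, (le_inv_comm₀ hs (by positivity)).2 hb, ?_⟩
  have h := (inv_lt_comm₀ hs (by positivity)).1 hb'
  rw [pow_succ, mul_inv] at h
  linarith

theorem prod_rpow_eq_of_sum_eq_one {n : ℕ} {τ : Fin n → ℝ} (hτ : ∑ i, τ i = 1) {ρ : ℝ}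
    (hρ : 0 < ρ) : ∏ i, ρ ^ τ i = ρ := by
  rw [← Real.rpow_sum_of_pos hρ, hτ, Real.rpow_one]

/-- Large sides are `ρ ^ τ i` rounded up, small sides are `ψ i` rounded down. Each rounding costs a
factor at most 2, hence `4 ^ n` in the ratio of volumes. -/
theorem exists_dyadic_scales {n : ℕ} {τ : Fin n → ℝ} (hτ0 : ∀ i, 0 < τ i) (hτ : ∑ i, τ i = 1)
    {ρ : ℝ} (hρ : 0 < ρ) (hρ1 : ρ ≤ 1) {ψ : Fin n → ℝ} (hψ0 : ∀ i, 0 < ψ i)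
    (hψ : ∀ i, ψ i ≤ ρ ^ τ i) :
    ∃ m a : Fin n → ℕ, (∀ i, m i ≤ a i) ∧ ρ ≤ ∏ i, ((2 : ℝ) ^ m i)⁻¹ ∧
      (∀ i, ((2 : ℝ) ^ m i)⁻¹ ≤ 2 * ρ ^ τ i) ∧ (∀ i, ((2 : ℝ) ^ a i)⁻¹ ≤ ψ i) ∧
      (∀ i, ψ i / 2 ≤ ((2 : ℝ) ^ a i)⁻¹) ∧
      (4 ^ n)⁻¹ * ((∏ i, ψ i) / ρ) ≤ ∏ i, (2 : ℝ) ^ m i / 2 ^ a i := by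
  have hρτ : ∀ i, ρ ^ τ i ≤ 1 := fun i => Real.rpow_le_one hρ.le hρ1 (hτ0 i).le
  choose m hm hm' using fun i => exists_two_pow_inv_near (Real.rpow_pos_of_pos hρ (τ i)) (hρτ i)
  choose b hb hb' using fun i => exists_two_pow_inv_near (hψ0 i) ((hψ i).trans (hρτ i))
  -- The exponent `b i + 1` turns rounding up into rounding down.
  have ha : ∀ i, ((2 : ℝ) ^ (b i + 1))⁻¹ ≤ ψ i := by
    intro i
    rw [pow_succ, mul_inv]
    linarith [hb' i]
  have ha' : ∀ i, ψ i / 2 ≤ ((2 : ℝ) ^ (b i + 1))⁻¹ := by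
    intro i
    rw [pow_succ, mul_inv]
    linarith [hb i]
  refine ⟨m, fun i => b i + 1, fun i => ?_, ?_, hm', ha, ha', ?_⟩
  · have h := (ha i).trans ((hψ i).trans (hm i))
    rwa [inv_le_inv₀ (by positivity) (by positivity), pow_le_pow_iff_right₀ one_lt_two] at h
  · calc ρ = ∏ i, ρ ^ τ i := (prod_rpow_eq_of_sum_eq_one hτ hρ).symm
      _ ≤ _ := Finset.prod_le_prod (fun i _ => by positivity) fun i _ => hm i
  · calc (4 ^ n)⁻¹ * ((∏ i, ψ i) / ρ) = ∏ i, (4⁻¹ * (ψ i / ρ ^ τ i)) := by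
          rw [Finset.prod_mul_distrib, Finset.prod_div_distrib, prod_rpow_eq_of_sum_eq_one hτ hρ]
          simp
      _ ≤ _ := by
          refine Finset.prod_le_prod (fun i _ => ?_) fun i _ => ?_
          · have := hψ0 i
            positivity
          · have h1 : 0 < ρ ^ τ i := by positivity
            have h2 : ((2 : ℝ) * ρ ^ τ i)⁻¹ ≤ 2 ^ m i :=
              (inv_le_comm₀ (by positivity) (by positivity)).1 (hm' i)
            calc 4⁻¹ * (ψ i / ρ ^ τ i) = (2 * ρ ^ τ i)⁻¹ * (ψ i / 2) := by field_simp; ring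
              _ ≤ 2 ^ m i * ((2 : ℝ) ^ (b i + 1))⁻¹ :=
                mul_le_mul h2 (ha' i) (by linarith [hψ0 i]) (by positivity)
              _ = _ := (div_eq_mul_inv _ _).symm

/-- If each `ψ i` is at most `ρ ^ τ i`, none of them is smaller than that by more than a factor
`ρ / ∏ ψ i`. -/
theorem rpow_mul_prod_div_le {n : ℕ} {τ : Fin n → ℝ} (hτ : ∑ i, τ i = 1)
    {ρ : ℝ} (hρ : 0 < ρ) {ψ : Fin n → ℝ} (hψ0 : ∀ i, 0 ≤ ψ i) (hψ : ∀ i, ψ i ≤ ρ ^ τ i)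
    (i : Fin n) : ρ ^ τ i * ((∏ l, ψ l) / ρ) ≤ ψ i := by
  have h1 : 0 < ρ ^ τ i := by positivity
  have h2 : (∏ l, ψ l) / ρ = ∏ l, ψ l / ρ ^ τ l := by
    rw [Finset.prod_div_distrib, prod_rpow_eq_of_sum_eq_one hτ hρ]
  have h3 : ∏ l, ψ l / ρ ^ τ l ≤ ψ i / ρ ^ τ i := by
    rw [← Finset.mul_prod_erase _ _ (Finset.mem_univ i)]
    refine mul_le_of_le_one_right (div_nonneg (hψ0 i) h1.le) ?_
    exact Finset.prod_le_one (fun l _ => div_nonneg (hψ0 l) (by positivity))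
      fun l _ => div_le_one_of_le₀ (hψ l) (by positivity)
  rw [h2, mul_comm]
  exact (le_div_iff₀ h1).1 h3

/-! ### Decay along the times `M ^ (j ^ 2)` -/

theorem sq_exp_ratio_pos {M : ℝ} (hM : 1 < M) (n : ℕ) {j : ℕ} (hj : 1 ≤ j) :
    0 < (j : ℝ) ^ (2 * n) / M ^ (j ^ 2) := by
  have : (0 : ℝ) < j := by exact_mod_cast hj
  positivity

theorem tendsto_sq_exp_ratio {M : ℝ} (hM : 1 < M) (n : ℕ) :
    Tendsto (fun j : ℕ => (j : ℝ) ^ (2 * n) / M ^ (j ^ 2)) atTop (nhds 0) := by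
  have hM0 : 0 < M := one_pos.trans hM
  have h := tendsto_pow_const_mul_const_pow_of_abs_lt_one (2 * n) (r := M⁻¹)
    (by rw [abs_of_pos (by positivity)]; exact inv_lt_one_of_one_lt₀ hM)
  refine squeeze_zero (fun j => by positivity) (fun j => ?_) h
  rw [inv_pow, ← div_eq_mul_inv]
  have : M ^ j ≤ M ^ (j ^ 2) := pow_le_pow_right₀ hM.le (Nat.le_self_pow two_ne_zero j)
  gcongr

theorem sq_exp_ratio_succ_le {M : ℝ} (hM : 1 < M) (n : ℕ) {j : ℕ} (hj : 1 ≤ j) :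
    ((j + 1 : ℕ) : ℝ) ^ (2 * n) / M ^ ((j + 1) ^ 2) ≤
      (j : ℝ) ^ (2 * n) / M ^ (j ^ 2) * (4 ^ n * M⁻¹ ^ j) := by
  have hM0 : 0 < M := one_pos.trans hM
  have hj1 : (1 : ℝ) ≤ j := by exact_mod_cast hj
  have h1 : ((j + 1 : ℕ) : ℝ) ^ (2 * n) ≤ 4 ^ n * (j : ℝ) ^ (2 * n) := by
    calc ((j + 1 : ℕ) : ℝ) ^ (2 * n) ≤ (2 * (j : ℝ)) ^ (2 * n) := by
          gcongr
          push_cast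
          linarith
      _ = _ := by rw [mul_pow, pow_mul]; norm_num
  have h2 : M ^ (j ^ 2) * M ^ j ≤ M ^ ((j + 1) ^ 2) := by
    rw [← pow_add]
    exact pow_le_pow_right₀ hM.le (by nlinarith)
  calc _ ≤ 4 ^ n * (j : ℝ) ^ (2 * n) / (M ^ (j ^ 2) * M ^ j) := by gcongr
    _ = _ := by rw [inv_pow]; field_simp

/-- The step from `j` to `j + 1` already gains `(4 ^ n * M⁻¹ ^ j) ^ τ`, which beats `c * j ^ 2`.
Eventual monotonicity passes to all `k > j`. -/
theorem eventually_sq_exp_ratio_separated {M : ℝ} (hM : 1 < M) (n : ℕ) {K τ : ℝ} (hK : 0 < K)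
    (hτ : 0 < τ) (c : ℝ) : ∀ᶠ j : ℕ in atTop, ∀ k : ℕ, j < k →
      c * (j : ℝ) ^ 2 * (K * ((k : ℝ) ^ (2 * n) / M ^ (k ^ 2))) ^ τ ≤
        (K * ((j : ℝ) ^ (2 * n) / M ^ (j ^ 2))) ^ τ := by
  have hM0 : 0 < M := one_pos.trans hM
  have hs1 : M⁻¹ < 1 := inv_lt_one_of_one_lt₀ hM
  set q : ℕ → ℝ := fun j => (j : ℝ) ^ (2 * n) / M ^ (j ^ 2) with hq
  have hq0 : ∀ j, 0 ≤ q j := fun j => by positivity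
  have hr : ∀ᶠ j : ℕ in atTop, (4 : ℝ) ^ n * M⁻¹ ^ j ≤ 1 := by
    have := (tendsto_pow_atTop_nhds_zero_of_lt_one (inv_pos.2 hM0).le hs1).const_mul ((4 : ℝ) ^ n)
    rw [mul_zero] at this
    exact this.eventually_le_const one_pos
  obtain ⟨J, hJ⟩ := eventually_atTop.1 hr
  have hanti : ∀ j k, max J 1 ≤ j → j ≤ k → q k ≤ q j := by
    intro j k hj hjk
    refine antitoneOn_nat_Ici_of_succ_le (k := max J 1) (fun l hl => ?_) hj (hj.trans hjk) hjk
    refine (sq_exp_ratio_succ_le hM n (le_of_max_le_right hl)).trans ?_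
    exact mul_le_of_le_one_right (hq0 l) (hJ l (le_of_max_le_left hl))
  have hlim : ∀ᶠ j : ℕ in atTop, |c| * (j : ℝ) ^ 2 * ((4 : ℝ) ^ n * M⁻¹ ^ j) ^ τ ≤ 1 := by
    have hr0 : (0 : ℝ) < M⁻¹ ^ τ := by positivity
    have h := (tendsto_pow_const_mul_const_pow_of_abs_lt_one 2 (r := M⁻¹ ^ τ)
      (by rw [abs_of_pos hr0]; exact Real.rpow_lt_one (by positivity) hs1 hτ)).const_mul
        (|c| * ((4 : ℝ) ^ n) ^ τ)
    rw [mul_zero] at h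
    filter_upwards [h.eventually_le_const one_pos] with j hj
    refine le_of_eq_of_le ?_ hj
    rw [Real.mul_rpow (by positivity) (by positivity), Real.rpow_pow_comm (by positivity)]
    ring
  filter_upwards [hlim, eventually_ge_atTop (max J 1)] with j hj hjJ k hjk
  have h1 : q k ≤ q j * (4 ^ n * M⁻¹ ^ j) :=
    (hanti (j + 1) k (hjJ.trans j.le_succ) hjk).trans
      (sq_exp_ratio_succ_le hM n (le_of_max_le_right hjJ))
  change c * (j : ℝ) ^ 2 * (K * q k) ^ τ ≤ (K * q j) ^ τ
  have hKq : 0 ≤ K * q j := mul_nonneg hK.le (hq0 j)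
  calc c * (j : ℝ) ^ 2 * (K * q k) ^ τ
      ≤ |c| * (j : ℝ) ^ 2 * ((K * q j) * (4 ^ n * M⁻¹ ^ j)) ^ τ := by
        have : K * q k ≤ (K * q j) * (4 ^ n * M⁻¹ ^ j) := by
          rw [mul_assoc]
          exact mul_le_mul_of_nonneg_left h1 hK.le
        have h0 : 0 ≤ K * q k := mul_nonneg hK.le (hq0 k)
        gcongr
        exact le_abs_self c
    _ = (|c| * (j : ℝ) ^ 2 * (4 ^ n * M⁻¹ ^ j) ^ τ) * (K * q j) ^ τ := by
        rw [Real.mul_rpow hKq (by positivity)]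
        ring
    _ ≤ 1 * (K * q j) ^ τ := by gcongr
    _ = _ := one_mul _

theorem one_le_floor_pow {M : ℝ} (hM : 1 < M) (j : ℕ) : 1 ≤ ⌊M ^ j⌋₊ :=
  Nat.le_floor (by exact_mod_cast one_le_pow₀ hM.le)

theorem tendsto_floor_pow_sq {M : ℝ} (hM : 1 < M) :
    Tendsto (fun j : ℕ => ⌊M ^ (j ^ 2)⌋₊) atTop atTop :=
  tendsto_nat_floor_atTop.comp
    ((tendsto_pow_atTop_atTop_of_one_lt hM).comp (tendsto_pow_atTop two_ne_zero))

theorem HasLowDiscrepancy.exists_lt {n : ℕ} {ω : ℕ → Fin n → ℝ} (h : HasLowDiscrepancy ω)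
    {M : ℝ} (hM : 1 < M) : ∃ K : ℝ, 0 < K ∧ ∀ᶠ j : ℕ in atTop,
      discrepancy ω ⌊M ^ (j ^ 2)⌋₊ < K * ((j : ℝ) ^ (2 * n) / M ^ (j ^ 2)) := by
  obtain ⟨C, hC⟩ := h.bound
  have hM0 : 0 < M := one_pos.trans hM
  have hlog : 0 < Real.log M := Real.log_pos hM
  -- The 2 absorbs the integer part (`N ≥ M ^ (j ^ 2) / 2`); the 1 makes the inequality strict and
  -- the constant positive.
  refine ⟨|C| * Real.log M ^ n * 2 + 1, by positivity, ?_⟩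
  filter_upwards [(tendsto_floor_pow_sq hM).eventually hC, eventually_ge_atTop 1] with j hj hj1
  set N := ⌊M ^ (j ^ 2)⌋₊ with hN
  have hN1 : 1 ≤ N := one_le_floor_pow hM _
  have hN1' : (1 : ℝ) ≤ N := by exact_mod_cast hN1
  have hNle : (N : ℝ) ≤ M ^ (j ^ 2) := Nat.floor_le (by positivity)
  have hNge : M ^ (j ^ 2) / 2 ≤ N := by
    have := Nat.lt_floor_add_one (M ^ (j ^ 2))
    rw [← hN] at this
    linarith
  have hlogN0 : 0 ≤ Real.log N := Real.log_nonneg hN1'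
  have hlogN : Real.log N ≤ (j : ℝ) ^ 2 * Real.log M := by
    have := Real.log_le_log (by linarith) hNle
    rwa [Real.log_pow, Nat.cast_pow] at this
  rw [Real.norm_of_nonneg (by positivity : 0 ≤ Real.log (N : ℝ) ^ n / N)] at hj
  calc discrepancy ω N ≤ C * (Real.log N ^ n / N) := (le_abs_self _).trans hj
    _ ≤ |C| * (((j : ℝ) ^ 2 * Real.log M) ^ n / (M ^ (j ^ 2) / 2)) := by
        gcongr
        exact le_abs_self C
    _ = |C| * Real.log M ^ n * 2 * ((j : ℝ) ^ (2 * n) / M ^ (j ^ 2)) := by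
        rw [mul_pow, ← pow_mul]
        field_simp
    _ < _ := mul_lt_mul_of_pos_right (lt_add_one _) (sq_exp_ratio_pos hM n hj1)

/-! ### Thinning the series and passing to infinitely many indices -/

/-- Discarding the terms below `1 / k ^ 2` and finitely many others, and replacing the rest by
comparable ones, keeps a divergent series divergent. -/
theorem not_summable_indicator_of_tendsto {t p : ℕ → ℝ} (ht : ∀ j, 0 ≤ t j)
    (hdiv : Tendsto (fun J : ℕ => ∑ j ∈ Finset.Icc 1 J, t j) atTop atTop) (J₀ : ℕ) {c : ℝ}
    (hc : 0 < c) (hp : ∀ j, J₀ ≤ j → 1 / (j : ℝ) ^ 2 ≤ t j → c * t j ≤ p j) :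
    ¬ Summable ({j | J₀ ≤ j ∧ 1 / (j : ℝ) ^ 2 ≤ t j}.indicator p) := by
  intro hs
  set S := {j : ℕ | J₀ ≤ j ∧ 1 / (j : ℝ) ^ 2 ≤ t j} with hS
  have hpsq : Summable fun j : ℕ => 1 / (j : ℝ) ^ 2 :=
    Real.summable_one_div_nat_pow.2 one_lt_two
  have hsum : Summable t := by
    refine Summable.of_norm_bounded_eventually_nat ((hs.mul_left c⁻¹).add hpsq) ?_
    filter_upwards [eventually_ge_atTop J₀] with j hj
    rw [Real.norm_of_nonneg (ht j)]
    have h2 : 0 ≤ 1 / (j : ℝ) ^ 2 := by positivity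
    by_cases hjS : j ∈ S
    · have h1 : t j ≤ c⁻¹ * p j := (le_inv_mul_iff₀ hc).2 (hp j hj hjS.2)
      rw [Set.indicator_of_mem hjS]
      linarith
    · rw [Set.indicator_of_notMem hjS, mul_zero, zero_add]
      exact (not_le.1 fun h => hjS ⟨hj, h⟩).le
  obtain ⟨J, hJ⟩ := (hdiv.eventually_gt_atTop (∑' j, t j)).exists
  exact (hsum.sum_le_tsum _ fun j _ => ht j).not_gt hJ

/-- Finitely many `ω j` different from `x` stay at positive distance from it, while `ψ i (N k) → 0`;
so the near points cannot all come from finitely many indices. -/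
theorem infinite_of_frequently_near {n : ℕ} {ω : ℕ → Fin n → ℝ} {ψ : Fin n → ℕ → ℝ}
    (hψ_anti : ∀ i, AntitoneOn (ψ i) (Set.Ici 1)) {N : ℕ → ℕ}
    (hψ : ∀ i, Tendsto (fun k => ψ i (N k)) atTop (nhds 0)) {x : Fin n → ℝ}
    (hx : x ∉ Set.range ω)
    (hf : ∃ᶠ k in atTop, ∃ y ∈ ω '' Set.Icc 1 (N k), ∀ i, |x i - y i| < ψ i (N k)) :
    {j : ℕ | 1 ≤ j ∧ ∀ i, |x i - ω j i| < ψ i j}.Infinite := by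
  intro hfin
  have hev : ∀ᶠ k in atTop, ∀ j ∈ {j : ℕ | 1 ≤ j ∧ ∀ i, |x i - ω j i| < ψ i j},
      ∃ i, ψ i (N k) < |x i - ω j i| := by
    rw [eventually_all_finite hfin]
    intro j _
    obtain ⟨i, hi⟩ := Function.ne_iff.1 (fun h => hx ⟨j, h⟩ : ω j ≠ x)
    have hpos : 0 < |x i - ω j i| := abs_pos.2 (sub_ne_zero.2 hi.symm)
    exact ((hψ i).eventually_lt_const hpos).mono fun k hk => ⟨i, hk⟩
  obtain ⟨k, ⟨_, ⟨j, hj, rfl⟩, hnear⟩, hk⟩ := (hf.and_eventually hev).exists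
  obtain ⟨i, hi⟩ := hk j ⟨hj.1, fun i =>
    (hnear i).trans_le (hψ_anti i hj.1 (hj.1.trans hj.2) hj.2)⟩
  exact (hnear i).not_gt hi

theorem approxSet_subset_Icc {n : ℕ} (ω : ℕ → Fin n → ℝ) (ψ : Fin n → ℕ → ℝ) :
    approxSet ω ψ ⊆ Set.Icc 0 1 :=
  fun _ hx => ⟨fun i => (hx.1 i).1, fun i => (hx.1 i).2⟩

end UnifApprox

/-! ### The main theorem -/

open UnifApprox in
theorem mainTheorem3 (n : ℕ) (τ : Fin n → ℝ) (hτ_pos : ∀ i, 0 < τ i) (hτ_sum : ∑ i, τ i = 1)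
    (ω : ℕ → Fin n → ℝ) (hω : ∀ j, 1 ≤ j → ∀ i, 0 ≤ ω j i ∧ ω j i ≤ 1)
    (hlow : UnifApprox.HasLowDiscrepancy ω)
    (ψ : Fin n → ℕ → ℝ) (hψ_nonneg : ∀ i N, 1 ≤ N → 0 ≤ ψ i N)
    (hψ_anti : ∀ i, AntitoneOn (ψ i) (Set.Ici 1))
    (hψ_le : ∀ᶠ N : ℕ in atTop, ∀ i, ψ i N ≤ UnifApprox.discrepancy ω N ^ τ i)
    (hdiv : ∃ M : ℝ, 1 < M ∧
      Tendsto (fun J : ℕ => ∑ j ∈ Finset.Icc 1 J,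
        M ^ (j ^ 2) / (j : ℝ) ^ (2 * n) * ∏ i, ψ i ⌊M ^ (j ^ 2)⌋₊) atTop atTop) :
    volume (UnifApprox.approxSet ω ψ) = 1 := by
  obtain ⟨M, hM, hdiv⟩ := hdiv
  have hM0 : 0 < M := one_pos.trans hM
  obtain ⟨K, hK, hKD⟩ := hlow.exists_lt hM
  -- Needed for countable sets to be null: in dimension 0 a point has measure 1.
  have : Nonempty (Fin n) := by
    by_contra h
    rw [not_nonempty_iff] at h
    simp at hτ_sum
  set N : ℕ → ℕ := fun j => ⌊M ^ (j ^ 2)⌋₊ with hN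
  have hN1 : ∀ j, 1 ≤ N j := fun j => one_le_floor_pow hM _
  set ρ : ℕ → ℝ := fun j => K * ((j : ℝ) ^ (2 * n) / M ^ (j ^ 2)) with hρ
  set t : ℕ → ℝ := fun j => M ^ (j ^ 2) / (j : ℝ) ^ (2 * n) * ∏ i, ψ i (N j) with ht
  have ht0 : ∀ j, 0 ≤ t j := fun j =>
    mul_nonneg (by positivity) (Finset.prod_nonneg fun i _ => hψ_nonneg i _ (hN1 j))
  have htρ : ∀ j, (∏ i, ψ i (N j)) / ρ j = K⁻¹ * t j := by
    intro j
    simp only [ht, hρ]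
    rw [div_eq_mul_inv, mul_inv, inv_div]
    ring
  have hρlim : Tendsto ρ atTop (nhds 0) := by
    have := (tendsto_sq_exp_ratio hM n).const_mul K
    rwa [mul_zero] at this
  have hψρ : ∀ᶠ j in atTop, ∀ i, ψ i (N j) ≤ ρ j ^ τ i := by
    filter_upwards [(tendsto_floor_pow_sq hM).eventually hψ_le, hKD] with j hj hjD i
    have hD0 : 0 ≤ discrepancy ω (N j) :=
      Real.sSup_nonneg (by rintro d ⟨a, b, -, rfl⟩; exact abs_nonneg _)
    exact (hj i).trans (Real.rpow_le_rpow hD0 hjD.le (hτ_pos i).le)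
  have hψlim : ∀ i, Tendsto (fun k => ψ i (N k)) atTop (nhds 0) := by
    intro i
    have := hρlim.rpow_const (Or.inr (hτ_pos i).le)
    rw [Real.zero_rpow (hτ_pos i).ne'] at this
    exact squeeze_zero' (Eventually.of_forall fun k => hψ_nonneg i _ (hN1 k))
      (hψρ.mono fun k hk => hk i) this
  -- In `4 * K`, the 4 pays for the two dyadic roundings and `K` for passing from `(∏ i, ψ i (N j))
  -- / ρ j` to `t j`.
  have hsep := eventually_all.2 fun i =>
    eventually_sq_exp_ratio_separated hM n hK (hτ_pos i) (4 * K)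
  obtain ⟨J₀, hJ₀⟩ := eventually_atTop.1 ((eventually_ge_atTop 1).and
    (hKD.and (hψρ.and (hsep.and (hρlim.eventually_le_const one_pos)))))
  set S := {j : ℕ | J₀ ≤ j ∧ 1 / (j : ℝ) ^ 2 ≤ t j} with hS
  have hscales : ∀ j, ∃ m a : Fin n → ℕ, j ∈ S →
      (∀ i, m i ≤ a i) ∧ ρ j ≤ ∏ i, ((2 : ℝ) ^ m i)⁻¹ ∧
      (∀ i, ((2 : ℝ) ^ m i)⁻¹ ≤ 2 * ρ j ^ τ i) ∧ (∀ i, ((2 : ℝ) ^ a i)⁻¹ ≤ ψ i (N j)) ∧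
      (∀ i, ψ i (N j) / 2 ≤ ((2 : ℝ) ^ a i)⁻¹) ∧
      (4 ^ n)⁻¹ * ((∏ i, ψ i (N j)) / ρ j) ≤ ∏ i, (2 : ℝ) ^ m i / 2 ^ a i := by
    intro j
    by_cases hj : j ∈ S
    · obtain ⟨hj1, -, hjψ, -, hjρ⟩ := hJ₀ j hj.1
      -- The threshold defining `S` forces every `ψ i (N j)` to be nonzero.
      have htpos : 0 < t j := by
        have : (0 : ℝ) < j := by exact_mod_cast hj1
        exact lt_of_lt_of_le (by positivity) hj.2
      have hψpos : ∀ i, 0 < ψ i (N j) := fun i =>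
        (hψ_nonneg i _ (hN1 j)).lt_of_ne' fun h0 => by
          have hprod : ∏ i, ψ i (N j) = 0 := Finset.prod_eq_zero (Finset.mem_univ i) h0
          simp [ht, hprod] at htpos
      obtain ⟨m, a, h⟩ := exists_dyadic_scales hτ_pos hτ_sum
        (mul_pos hK (sq_exp_ratio_pos hM n hj1)) hjρ hψpos hjψ
      exact ⟨m, a, fun _ => h⟩
    · exact ⟨0, 0, fun h => (hj h).elim⟩
  choose m a hma using hscales
  have hzero := volume_not_frequently_near_eq_zero (S := S) (m := m) (a := a)
    (P := fun k => ω '' Set.Icc 1 (N k)) (fun k hk => (hma k hk).1) ?_ ?_ ?_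
  · have hsub : unitBox n ⊆ approxSet ω ψ ∪ ({x ∈ unitBox n | ¬ ∃ᶠ k in atTop,
        k ∈ S ∧ ∃ y ∈ ω '' Set.Icc 1 (N k), ∀ i, |x i - y i| < ((2 : ℝ) ^ a k i)⁻¹} ∪
          Set.range ω) := by
      intro x hx
      by_cases hxω : x ∈ Set.range ω
      · exact Or.inr (Or.inr hxω)
      by_cases hf : ∃ᶠ k in atTop, k ∈ S ∧ ∃ y ∈ ω '' Set.Icc 1 (N k),
          ∀ i, |x i - y i| < ((2 : ℝ) ^ a k i)⁻¹
      · refine Or.inl ⟨fun i => ⟨(mem_unitBox.1 hx i).1, (mem_unitBox.1 hx i).2.le⟩,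
          infinite_of_frequently_near hψ_anti hψlim hxω (hf.mono ?_)⟩
        rintro k ⟨hk, y, hy, hxy⟩
        exact ⟨y, hy, fun i => (hxy i).trans_le ((hma k hk).2.2.2.1 i)⟩
      · exact Or.inr (Or.inl ⟨hx, hf⟩)
    refine le_antisymm ?_ ?_
    · refine (measure_mono (approxSet_subset_Icc ω ψ)).trans ?_
      rw [Real.volume_Icc_pi]
      simp
    · have hnull := measure_union_null hzero ((Set.countable_range ω).measure_zero volume)
      calc 1 = volume (unitBox n) := (volume_unitBox n).symm
        _ ≤ _ := measure_mono hsub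
        _ ≤ _ := measure_union_le _ _
        _ = _ := by rw [hnull, add_zero]
  · intro j hj k hk hjk i
    obtain ⟨hj1, -, hjψ, hjsep, -⟩ := hJ₀ j hj.1
    have hjpos : (0 : ℝ) < j := by exact_mod_cast hj1
    have hρj : 0 < ρ j := mul_pos hK (sq_exp_ratio_pos hM n hj1)
    have h1 := rpow_mul_prod_div_le hτ_sum hρj (fun i => hψ_nonneg i _ (hN1 j)) hjψ i
    have h2 : 4 * K * (j : ℝ) ^ 2 * ρ k ^ τ i ≤ ρ j ^ τ i := hjsep i k hjk
    have h3 : 4 * ρ k ^ τ i ≤ ψ i (N j) := by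
      refine le_trans ?_ h1
      rw [htρ]
      calc 4 * ρ k ^ τ i = (4 * K * (j : ℝ) ^ 2 * ρ k ^ τ i) * (K⁻¹ * (1 / (j : ℝ) ^ 2)) := by
            field_simp
        _ ≤ ρ j ^ τ i * (K⁻¹ * t j) := by
            gcongr
            exact hj.2
    have h4 : ((2 : ℝ) ^ m k i)⁻¹ ≤ ((2 : ℝ) ^ a j i)⁻¹ := by
      have h5 := (hma k hk).2.2.1 i
      have h6 := (hma j hj).2.2.2.2.1 i
      linarith
    rwa [inv_le_inv₀ (by positivity) (by positivity), pow_le_pow_iff_right₀ one_lt_two] at h4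
  · intro k hk x hx
    exact exists_dyadicIndex_eq ((hJ₀ k hk.1).2.1.trans_le (hma k hk).2.1) hx
  · refine not_summable_indicator_of_tendsto ht0 hdiv J₀ (c := (4 ^ n)⁻¹ * K⁻¹) (by positivity) ?_
    intro j hj hjt
    have := (hma j ⟨hj, hjt⟩).2.2.2.2.2
    rwa [htρ, ← mul_assoc] at this
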